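/- Let $p\ge 7$ be a prime, let $m,s\ge 1$ be integers and $q=p^m$ with $5\mid (q-1)$, and let $\omega\in\mathbb F_q$ be a primitive $5$-th root of unity. Identify a word $(c_0,\dots,c_{n-1})\in\mathbb F_q^n$, $n=5p^s$, with the class of $c_0+c_1x+\dots+c_{n-1}x^{n-1}$ in $\mathbb F_q[x]/(x^n-1)$, and write $\langle g\rangle$ for the code formed by the ideal generated by $g$. Let $d_H$ denote the minimum Hamming distance between distinct codewords, with $d_H(\{\mathbf 0\})=0$. Then every (linear) cyclic code of length $5p^s$ over $\mathbb F_q$ has the form $$\mathcal C=\langle (x-1)^{i_0}(x-\omega)^{i_1}(x-\omega^2)^{i_2}(x-\omega^3)^{i_3}(x-\omega^4)^{i_4}\rangle,\qquad 0\le i_0,\dots,i_4\le p^s.$$ Moreover, if $0\le i_4\le i_3\le i_2\le i_1\le i_0\le p^s$, then the following table covers all cases and each of its rows that applies gives $d_H(\mathcal C)$. If $i_4=0$: * $i_0=i_1=i_2=i_3=0$: $d_H(\mathcal C)=1$. * $0<i_0\le p^{s-1}$ and $0\le i_1,i_2,i_3\le p^{s-1}$: $d_H(\mathcal C)=2$.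 * $p^{s-1}<i_0\le p^s$ and $i_1=i_2=i_3=0$: $d_H(\mathcal C)=2$. * $p^{s-1}<i_0\le 2p^{s-1}$, $0<i_1\le p^s$ and $0\le i_2,i_3\le p^s$: $d_H(\mathcal C)=3$. * $2p^{s-1}<i_0\le p^s$, $0<i_1\le p^s$ and $i_2=i_3=0$: $d_H(\mathcal C)=3$. * $2p^{s-1}<i_0\le 3p^{s-1}$, $0<i_1,i_2\le p^s$ and $0\le i_3\le p^s$: $d_H(\mathcal C)=4$. * $3p^{s-1}<i_0\le p^s$, $0<i_1,i_2\le p^s$ and $i_3=0$: $d_H(\mathcal C)=4$. * $3p^{s-1}<i_0\le p^s$ and $0<i_1,i_2,i_3\le p^{s-1}$: $d_H(\mathcal C)=4$. * $3p^{s-1}<i_0\le p^s$, $p^{s-1}<i_1\le p^s$ and $0<i_2,i_3\le p^s$: $d_H(\mathcal C)=5$. If $i_4>0$: let $k\in\{0,\dots,5\}$ be the number of indices $j$ with $i_j=p^s$, so that $i_0=\dots=i_{k-1}=p^s$. * If $k\le 4$ and, for $k\le j\le 4$, the integers $0\le\beta_j\le p-2$ and $0\le\tau_j\le s-1$ satisfy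 $$p^s-p^{s-\tau_j}+\beta_jp^{s-\tau_j-1}+1\le i_j\le p^s-p^{s-\tau_j}+(\beta_j+1)p^{s-\tau_j-1},$$ with $\tau_4\le\tau_3\le\dots\le\tau_k$ (such integers exist), then $$d_H(\mathcal C)=\min_{k\le j\le 4}\,(j+1)(\beta_j+2)p^{\tau_j}.$$ In particular, for $k=0$, $$d_H(\mathcal C)=\min\{(\beta_0+2)p^{\tau_0},\,2(\beta_1+2)p^{\tau_1},\,3(\beta_2+2)p^{\tau_2},\,4(\beta_3+2)p^{\tau_3},\,5(\beta_4+2)p^{\tau_4}\}.$$ * If $k=5$, i.e. $i_0=\dots=i_4=p^s$: $d_H(\mathcal C)=0$. -/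

import Mathlib

open Polynomial

noncomputable section

/-- A linear code of length `n` is cyclic if `(c₀, …, c_{n-1}) ∈ 𝒞` implies
`(c_{n-1}, c₀, …, c_{n-2}) ∈ 𝒞`. (`finRotate n` is `k ↦ k + 1` modulo `n`.) -/
def IsCyclicCode {F : Type*} [Field F] {n : ℕ} (𝒞 : Submodule F (Fin n → F)) : Prop :=
  ∀ c ∈ 𝒞, (fun k => c ((finRotate n).symm k)) ∈ 𝒞

/-- Minimum Hamming distance of a code: the least Hamming distance between two distinct
codewords. The zero code has no such pair, and its distance is `0`, since `sInf ∅ = 0` in `ℕ`. -/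
def minHammingDist {F : Type*} [Field F] {n : ℕ} (𝒞 : Submodule F (Fin n → F)) : ℕ :=
  letI := Classical.decEq F
  sInf {d | ∃ x ∈ 𝒞, ∃ y ∈ 𝒞, x ≠ y ∧ d = hammingDist x y}

/-- The residue class ring `F[x] / (x ^ n - 1)`. -/
abbrev CyclicRing (F : Type*) [Field F] (n : ℕ) : Type _ :=
  F[X] ⧸ Ideal.span {(X ^ n - 1 : F[X])}

/-- The identification of `(c₀, …, c_{n-1})` with the class of `c₀ + c₁ x + ⋯ + c_{n-1} x^{n-1}`
in `F[x] / (x ^ n - 1)`. -/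
def wordClass (F : Type*) [Field F] (n : ℕ) : (Fin n → F) →ₗ[F] CyclicRing F n where
  toFun c := Ideal.Quotient.mk _ (∑ k : Fin n, C (c k) * X ^ (k : ℕ))
  map_add' c d := by
    simp only [Pi.add_apply, add_mul, Finset.sum_add_distrib, map_add]
  map_smul' a c := by
    have h : (∑ k : Fin n, C ((a • c) k) * X ^ (k : ℕ) : F[X])
        = a • ∑ k : Fin n, C (c k) * X ^ (k : ℕ) := by
      simp only [Pi.smul_apply, smul_eq_mul, C_mul, Finset.smul_sum, smul_eq_C_mul, mul_assoc]
    rw [h]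
    rfl

/-- The code `⟨g⟩` of length `n`: the words that correspond to the elements of the ideal of
`F[x] / (x ^ n - 1)` generated by (the class of) `g`. -/
def codeGeneratedBy {F : Type*} [Field F] (n : ℕ) (g : F[X]) : Submodule F (Fin n → F) :=
  ((Ideal.span {(Ideal.Quotient.mk _ g : CyclicRing F n)}).restrictScalars F).comap
    (wordClass F n)

/-- The polynomial `(x-1)^{i₀} (x-ω)^{i₁} (x-ω²)^{i₂} (x-ω³)^{i₃} (x-ω⁴)^{i₄}`. -/
def generatorPoly {F : Type*} [Field F] (ω : F) (i : Fin 5 → ℕ) : F[X] :=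
  ∏ j : Fin 5, (X - C (ω ^ (j : ℕ))) ^ i j

/-- `l` lies in the `p`-adic interval with parameters `0 ≤ β ≤ p - 2`, `0 ≤ τ ≤ s - 1`:
`p^s - p^{s-τ} + β p^{s-τ-1} + 1 ≤ l ≤ p^s - p^{s-τ} + (β + 1) p^{s-τ-1}`. -/
def InPadicInterval (p s β τ l : ℕ) : Prop :=
  β ≤ p - 2 ∧ τ ≤ s - 1 ∧
    p ^ s - p ^ (s - τ) + β * p ^ (s - τ - 1) + 1 ≤ l ∧
    l ≤ p ^ s - p ^ (s - τ) + (β + 1) * p ^ (s - τ - 1)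

/-- The table of minimum distances: `DistanceTable p s i d` says that some row of the table
applies to the exponents `i₄ ≤ i₃ ≤ i₂ ≤ i₁ ≤ i₀` and has the entry `d`.
There is one constructor for each row. -/
inductive DistanceTable (p s : ℕ) (i : Fin 5 → ℕ) : ℕ → Prop
  | row1 (h0 : i 0 = 0) (h1 : i 1 = 0) (h2 : i 2 = 0) (h3 : i 3 = 0) (h4 : i 4 = 0) :
      DistanceTable p s i 1
  | row2 (h0 : 0 < i 0 ∧ i 0 ≤ p ^ (s - 1)) (h1 : i 1 ≤ p ^ (s - 1)) (h2 : i 2 ≤ p ^ (s - 1))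
      (h3 : i 3 ≤ p ^ (s - 1)) (h4 : i 4 = 0) :
      DistanceTable p s i 2
  | row3 (h0 : p ^ (s - 1) < i 0 ∧ i 0 ≤ p ^ s) (h1 : i 1 = 0) (h2 : i 2 = 0)
      (h3 : i 3 = 0) (h4 : i 4 = 0) :
      DistanceTable p s i 2
  | row4 (h0 : p ^ (s - 1) < i 0 ∧ i 0 ≤ 2 * p ^ (s - 1)) (h1 : 0 < i 1 ∧ i 1 ≤ p ^ s)
      (h2 : i 2 ≤ p ^ s) (h3 : i 3 ≤ p ^ s) (h4 : i 4 = 0) :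
      DistanceTable p s i 3
  | row5 (h0 : 2 * p ^ (s - 1) < i 0 ∧ i 0 ≤ p ^ s) (h1 : 0 < i 1 ∧ i 1 ≤ p ^ s)
      (h2 : i 2 = 0) (h3 : i 3 = 0) (h4 : i 4 = 0) :
      DistanceTable p s i 3
  | row6 (h0 : 2 * p ^ (s - 1) < i 0 ∧ i 0 ≤ 3 * p ^ (s - 1)) (h1 : 0 < i 1 ∧ i 1 ≤ p ^ s)
      (h2 : 0 < i 2 ∧ i 2 ≤ p ^ s) (h3 : i 3 ≤ p ^ s) (h4 : i 4 = 0) :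
      DistanceTable p s i 4
  | row7 (h0 : 3 * p ^ (s - 1) < i 0 ∧ i 0 ≤ p ^ s) (h1 : 0 < i 1 ∧ i 1 ≤ p ^ s)
      (h2 : 0 < i 2 ∧ i 2 ≤ p ^ s) (h3 : i 3 = 0) (h4 : i 4 = 0) :
      DistanceTable p s i 4
  | row8 (h0 : 3 * p ^ (s - 1) < i 0 ∧ i 0 ≤ p ^ s) (h1 : 0 < i 1 ∧ i 1 ≤ p ^ (s - 1))
      (h2 : 0 < i 2 ∧ i 2 ≤ p ^ (s - 1)) (h3 : 0 < i 3 ∧ i 3 ≤ p ^ (s - 1)) (h4 : i 4 = 0) :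
      DistanceTable p s i 4
  | row9 (h0 : 3 * p ^ (s - 1) < i 0 ∧ i 0 ≤ p ^ s) (h1 : p ^ (s - 1) < i 1 ∧ i 1 ≤ p ^ s)
      (h2 : 0 < i 2 ∧ i 2 ≤ p ^ s) (h3 : 0 < i 3 ∧ i 3 ≤ p ^ s) (h4 : i 4 = 0) :
      DistanceTable p s i 5
  | row10 (β₀ β₁ β₂ β₃ β₄ τ₀ τ₁ τ₂ τ₃ τ₄ : ℕ)
      (hτ : τ₄ ≤ τ₃ ∧ τ₃ ≤ τ₂ ∧ τ₂ ≤ τ₁ ∧ τ₁ ≤ τ₀)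
      (h0 : InPadicInterval p s β₀ τ₀ (i 0)) (h1 : InPadicInterval p s β₁ τ₁ (i 1))
      (h2 : InPadicInterval p s β₂ τ₂ (i 2)) (h3 : InPadicInterval p s β₃ τ₃ (i 3))
      (h4 : InPadicInterval p s β₄ τ₄ (i 4)) :
      DistanceTable p s i
        (min ((β₀ + 2) * p ^ τ₀) (min (2 * (β₁ + 2) * p ^ τ₁) (min (3 * (β₂ + 2) * p ^ τ₂)
          (min (4 * (β₃ + 2) * p ^ τ₃) (5 * (β₄ + 2) * p ^ τ₄)))))
  | row11 (β₁ β₂ β₃ β₄ τ₁ τ₂ τ₃ τ₄ : ℕ)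
      (hτ : τ₄ ≤ τ₃ ∧ τ₃ ≤ τ₂ ∧ τ₂ ≤ τ₁)
      (h0 : i 0 = p ^ s) (h1 : InPadicInterval p s β₁ τ₁ (i 1))
      (h2 : InPadicInterval p s β₂ τ₂ (i 2)) (h3 : InPadicInterval p s β₃ τ₃ (i 3))
      (h4 : InPadicInterval p s β₄ τ₄ (i 4)) :
      DistanceTable p s i
        (min (2 * (β₁ + 2) * p ^ τ₁) (min (3 * (β₂ + 2) * p ^ τ₂)
          (min (4 * (β₃ + 2) * p ^ τ₃) (5 * (β₄ + 2) * p ^ τ₄))))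
  | row12 (β₂ β₃ β₄ τ₂ τ₃ τ₄ : ℕ)
      (hτ : τ₄ ≤ τ₃ ∧ τ₃ ≤ τ₂)
      (h0 : i 0 = p ^ s) (h1 : i 1 = p ^ s)
      (h2 : InPadicInterval p s β₂ τ₂ (i 2)) (h3 : InPadicInterval p s β₃ τ₃ (i 3))
      (h4 : InPadicInterval p s β₄ τ₄ (i 4)) :
      DistanceTable p s i
        (min (3 * (β₂ + 2) * p ^ τ₂) (min (4 * (β₃ + 2) * p ^ τ₃) (5 * (β₄ + 2) * p ^ τ₄)))
  | row13 (β₃ β₄ τ₃ τ₄ : ℕ) (hτ : τ₄ ≤ τ₃)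
      (h0 : i 0 = p ^ s) (h1 : i 1 = p ^ s) (h2 : i 2 = p ^ s)
      (h3 : InPadicInterval p s β₃ τ₃ (i 3)) (h4 : InPadicInterval p s β₄ τ₄ (i 4)) :
      DistanceTable p s i (min (4 * (β₃ + 2) * p ^ τ₃) (5 * (β₄ + 2) * p ^ τ₄))
  | row14 (β₄ τ₄ : ℕ)
      (h0 : i 0 = p ^ s) (h1 : i 1 = p ^ s) (h2 : i 2 = p ^ s) (h3 : i 3 = p ^ s)
      (h4 : InPadicInterval p s β₄ τ₄ (i 4)) :
      DistanceTable p s i (5 * (β₄ + 2) * p ^ τ₄)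
  | row15 (h0 : i 0 = p ^ s) (h1 : i 1 = p ^ s) (h2 : i 2 = p ^ s) (h3 : i 3 = p ^ s)
      (h4 : i 4 = p ^ s) :
      DistanceTable p s i 0

end

/-!
Let `P t` be the product of `a + 1` over the base-`p` digits `a` of `t`, the weight of `(x - 1) ^ t`
in characteristic `p` (`digitProd`).

*The generators.* A cyclic code pulls back to an ideal of `F[X]` that contains `X ^ n - 1`, so it is
generated by a divisor of `X ^ n - 1 = ∏ (X - ω ^ j) ^ (p ^ s)`
(`exists_generatorPoly_of_isCyclicCode`).

*Weight retention.* A polynomial `v` splits as `∑_{r < n} x ^ r v_r (x ^ n)`. Multiplication by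
`(x ^ n - 1) ^ t` multiplies each `v_r (y)` by `(y - 1) ^ t`, and the residue of `v` modulo
`x ^ n - 1` is `∑ v_r (1) x ^ r`. Hence a lower bound for the weight of `(y - 1) ^ t w (y)` with
`w (1) ≠ 0` is gained once for each term of the residue (`Polynomial.exists_mul_card_support_le`).
For `n = p`, where `x ^ p - 1 = (x - 1) ^ p`, this gives by induction on the digits of `t` that such
a weight is at least `P t` (`Polynomial.digitProd_le_card_support`); the induction step needs that a
polynomial of degree less than `p` vanishing at `1` to order `k` has more than `k` terms. For
`n = 5`, write a nonzero codeword as `(x ^ 5 - 1) ^ t v` with `t` maximal, and let `j` be the first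
index with `i_j ≤ t`. The residue of `v` modulo `x ^ 5 - 1` has the roots `1, …, ω ^ (j - 1)`, so it
has more than `j` terms, and the codeword weighs at least `(j + 1) P t`.

*Attainment.* If `i_j ≤ t < p ^ s`, then `(∏_{l < j} (x - ω ^ l)) ^ (p ^ s) (x ^ 5 - 1) ^ t` gives a
nonzero codeword of weight at most `(j + 1) P t`. So the minimum distance is the least element of
the set of all these numbers (`minHammingDist_eq_of_isLeast`).

*The table.* On the interval with parameters `β`, `τ`, the least value of `P t` over `t` from a
given point up to `p ^ s - 1` is `(β + 2) p ^ τ`, taken at the right end of the interval, and these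
intervals partition the numbers strictly between `0` and `p ^ s`. The rows follow.
-/

open Polynomial

noncomputable section

/-! ### Weights of polynomials -/

theorem Polynomial.card_support_expand_le {F : Type*} [Field F] (n : ℕ) (hn : 0 < n) (f : F[X]) :
    (expand F n f).support.card ≤ f.support.card := by
  classical
  refine (Finset.card_le_card (?_ : _ ⊆ f.support.image (· * n))).trans Finset.card_image_le
  intro k hk
  rw [mem_support_iff, coeff_expand hn] at hk
  split_ifs at hk with h
  · exact Finset.mem_image.2 ⟨k / n, mem_support_iff.2 hk, Nat.div_mul_cancel h⟩
  · exact absurd rfl hk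

/-- A polynomial with the consecutive roots `1, ω, …, ω ^ (k - 1)` has more than `k` terms. The
combination `f (ω x) - ω ^ m f (x)` removes one term and costs one root. -/
theorem Polynomial.lt_card_support_of_roots {F : Type*} [Field F] {n : ℕ} {ω : F}
    (hω : IsPrimitiveRoot ω n) (k : ℕ) (f : F[X]) (hf : f ≠ 0) (hdeg : f.degree < n)
    (hroot : ∀ l < k, f.eval (ω ^ l) = 0) : k < f.support.card := by
  induction k generalizing f with
  | zero => exact Finset.card_pos.2 (nonempty_support_iff.2 hf)
  | succ k ih =>
    obtain ⟨m, hm⟩ := nonempty_support_iff.2 hf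
    set g : F[X] := f.comp (C ω * X) - C (ω ^ m) * f with hg
    have hcoeff : ∀ r, g.coeff r = (ω ^ r - ω ^ m) * f.coeff r := by
      intro r
      rw [hg, coeff_sub, comp_C_mul_X_coeff, coeff_C_mul]
      ring
    have hlt : ∀ r ∈ f.support, r < n := fun r hr =>
      (Nat.cast_lt (α := WithBot ℕ)).1 ((le_degree_of_mem_supp r hr).trans_lt hdeg)
    have hsupp : g.support = f.support.erase m := by
      ext r
      simp only [mem_support_iff, hcoeff, Finset.mem_erase, mul_ne_zero_iff, sub_ne_zero]
      refine and_congr_left fun hr => not_congr ⟨fun h => ?_, fun h => by rw [h]⟩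
      exact hω.pow_inj (hlt r (mem_support_iff.2 hr)) (hlt m hm) h
    have hg0 : g ≠ 0 := by
      intro h0
      have hs : f.support.erase m = ∅ := by rw [← hsupp, h0, support_zero]
      have h1 := hroot 0 k.succ_pos
      rw [pow_zero, eval_eq_sum, sum_def, ← Finset.add_sum_erase _ _ hm, hs] at h1
      simp at h1
      exact mem_support_iff.1 hm h1
    have hgdeg : g.degree < n := by
      refine (degree_lt_iff_coeff_zero _ _).2 fun r hr => ?_
      rw [hcoeff, (degree_lt_iff_coeff_zero _ _).1 hdeg r hr, mul_zero]
    have := ih g hg0 hgdeg fun l hl => by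
      rw [hg, eval_sub, eval_comp, eval_mul, eval_mul, eval_C, eval_X, eval_C, ← pow_succ',
        hroot _ (by omega), hroot _ (by omega), mul_zero, sub_zero]
    rw [hsupp, Finset.card_erase_of_mem hm] at this
    omega

/-- In characteristic `p`, a nonzero polynomial of degree less than `p` that vanishes at `1` to
order `k` has more than `k` terms. The combination `X f' - m f` removes one term and costs one
order of vanishing. -/
theorem Polynomial.lt_card_support_of_pow_dvd {F : Type*} [Field F] (p : ℕ) [CharP F p]
    (k : ℕ) (f : F[X]) (hf : f ≠ 0) (hdeg : f.degree < p)
    (hdvd : (X - 1) ^ k ∣ f) : k < f.support.card := by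
  induction k generalizing f with
  | zero => exact Finset.card_pos.2 (nonempty_support_iff.2 hf)
  | succ k ih =>
    obtain ⟨m, hm⟩ := nonempty_support_iff.2 hf
    set g : F[X] := X * derivative f - C (m : F) * f with hg
    have hcoeff : ∀ r, g.coeff r = ((r : F) - m) * f.coeff r := by
      intro r
      rw [hg, coeff_sub, coeff_C_mul]
      cases r with
      | zero => simp
      | succ r => rw [coeff_X_mul, coeff_derivative]; push_cast; ring
    have hlt : ∀ r ∈ f.support, r < p := fun r hr =>
      (Nat.cast_lt (α := WithBot ℕ)).1 ((le_degree_of_mem_supp r hr).trans_lt hdeg)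
    have hsupp : g.support = f.support.erase m := by
      ext r
      simp only [mem_support_iff, hcoeff, Finset.mem_erase, mul_ne_zero_iff, sub_ne_zero]
      refine and_congr_left fun hr => not_congr ⟨fun h => ?_, fun h => by rw [h]⟩
      have := (CharP.natCast_eq_natCast F p).1 h
      exact Nat.ModEq.eq_of_lt_of_lt this (hlt r (mem_support_iff.2 hr)) (hlt m hm)
    have hg0 : g ≠ 0 := by
      intro h0
      have hs : f.support.erase m = ∅ := by rw [← hsupp, h0, support_zero]
      have h1 : f.eval 1 = 0 := by
        obtain ⟨q, hq⟩ := (dvd_pow_self (X - 1 : F[X]) k.succ_ne_zero).trans hdvd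
        rw [hq]; simp
      rw [eval_eq_sum, sum_def, ← Finset.add_sum_erase _ _ hm, hs] at h1
      simp at h1
      exact mem_support_iff.1 hm h1
    have hgdeg : g.degree < p := by
      refine (degree_lt_iff_coeff_zero _ _).2 fun r hr => ?_
      rw [hcoeff, (degree_lt_iff_coeff_zero _ _).1 hdeg r hr, mul_zero]
    have hgdvd : (X - 1) ^ k ∣ g := by
      refine dvd_sub (Dvd.dvd.mul_left ?_ _) (((pow_dvd_pow _ k.le_succ).trans hdvd).mul_left _)
      exact (pow_sub_one_dvd_derivative_of_pow_dvd hdvd :)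
    have := ih g hg0 hgdeg hgdvd
    rw [hsupp, Finset.card_erase_of_mem hm] at this
    omega

/-! ### Weight retention -/

theorem Polynomial.exists_eq_sum_X_pow_mul_expand {F : Type*} [Field F] (n : ℕ) (hn : 0 < n)
    (f : F[X]) : ∃ u : ℕ → F[X], f = ∑ r ∈ Finset.range n, X ^ r * expand F n (u r) := by
  induction f using Polynomial.induction_on' with
  | add f g hf hg =>
    obtain ⟨u, hu⟩ := hf
    obtain ⟨v, hv⟩ := hg
    refine ⟨fun r => u r + v r, ?_⟩
    simp only [map_add, mul_add, Finset.sum_add_distrib]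
    rw [← hu, ← hv]
  | monomial k a =>
    refine ⟨fun r => if r = k % n then monomial (k / n) a else 0, ?_⟩
    rw [Finset.sum_eq_single (k % n)]
    · dsimp only
      rw [if_pos rfl, expand_monomial, X_pow_mul_monomial, Nat.div_add_mod']
    · intro r _ hr
      dsimp only
      rw [if_neg hr, map_zero, mul_zero]
    · exact fun h => absurd (Finset.mem_range.2 (Nat.mod_lt k hn)) h

theorem Polynomial.coeff_sum_X_pow_mul_expand {F : Type*} [Field F] {n : ℕ} (u : ℕ → F[X])
    {r : ℕ} (hr : r < n) (k : ℕ) :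
    (∑ r ∈ Finset.range n, X ^ r * expand F n (u r)).coeff (k * n + r) = (u r).coeff k := by
  have hn : 0 < n := by omega
  rw [finsetSum_coeff, Finset.sum_eq_single r]
  · rw [coeff_X_pow_mul, coeff_expand_mul hn]
  · intro r' hr' hne
    rw [Finset.mem_range] at hr'
    rw [coeff_X_pow_mul']
    split_ifs with hle
    · rw [coeff_expand hn, if_neg]
      rintro ⟨d, hd⟩
      have h : k * n + r = n * d + r' := by omega
      have h2 := congrArg (· % n) h
      simp only [Nat.mul_add_mod, Nat.mul_add_mod', Nat.mod_eq_of_lt hr, Nat.mod_eq_of_lt hr']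
        at h2
      exact hne h2.symm
    · rfl
  · exact fun h => absurd (Finset.mem_range.2 hr) h

theorem Polynomial.sum_card_support_le {F : Type*} [Field F] (n : ℕ) (u : ℕ → F[X]) :
    ∑ r ∈ Finset.range n, (u r).support.card ≤
      (∑ r ∈ Finset.range n, X ^ r * expand F n (u r)).support.card := by
  rw [← Finset.card_sigma]
  refine Finset.card_le_card_of_injOn (fun x => x.2 * n + x.1) ?_ ?_
  · rintro ⟨r, k⟩ h
    simp only [Finset.coe_sigma, Set.mem_sigma_iff, Finset.mem_coe, Finset.mem_range] at h
    rw [Finset.mem_coe, mem_support_iff, coeff_sum_X_pow_mul_expand u h.1]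
    exact mem_support_iff.1 h.2
  · rintro ⟨r, k⟩ h ⟨r', k'⟩ h' heq
    simp only [Finset.coe_sigma, Set.mem_sigma_iff, Finset.mem_coe, Finset.mem_range] at h h'
    have h1 := congrArg (· % n) heq
    have h2 := congrArg (· / n) heq
    have hn : 0 < n := by omega
    simp only [Nat.mul_add_mod', Nat.mod_eq_of_lt h.1, Nat.mod_eq_of_lt h'.1] at h1
    simp only [Nat.mul_comm _ n, Nat.mul_add_div hn, Nat.div_eq_of_lt h.1,
      Nat.div_eq_of_lt h'.1, add_zero] at h2
    subst h1 h2
    rfl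

/-- If every polynomial that vanishes at `1` to order exactly `t` has weight at least `P`, then
the weight of `(X ^ n - 1) ^ t * v` is at least `P` times the weight of the residue of `v`
modulo `X ^ n - 1`: each residue class of exponents modulo `n` that occurs in the residue
contributes at least `P` terms. -/
theorem Polynomial.exists_mul_card_support_le {F : Type*} [Field F] (n : ℕ) (hn : 0 < n)
    (t P : ℕ) (hP : ∀ w : F[X], w.eval 1 ≠ 0 → P ≤ ((X - 1) ^ t * w).support.card) (v : F[X]) :
    ∃ r : F[X], r.degree < n ∧ X ^ n - 1 ∣ v - r ∧
      P * r.support.card ≤ ((X ^ n - 1) ^ t * v).support.card := by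
  classical
  obtain ⟨u, hu⟩ := exists_eq_sum_X_pow_mul_expand n hn v
  have hexp : expand F n (X - 1) = X ^ n - 1 := by simp
  refine ⟨∑ r ∈ Finset.range n, C ((u r).eval 1) * X ^ r, ?_, ?_, ?_⟩
  · refine (degree_sum_le _ _).trans_lt ((Finset.sup_lt_iff (WithBot.bot_lt_coe n)).2 ?_)
    intro r hr
    exact (degree_C_mul_X_pow_le _ _).trans_lt (Nat.cast_lt.2 (Finset.mem_range.1 hr))
  · rw [hu, ← Finset.sum_sub_distrib]
    refine Finset.dvd_sum fun r _ => ?_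
    have h1 : X - 1 ∣ u r - C ((u r).eval 1) := by
      have := X_sub_C_dvd_sub_C_eval (a := (1 : F)) (p := u r)
      rwa [C_1] at this
    have h2 := _root_.map_dvd (expand F n) h1
    rw [hexp, map_sub, expand_C] at h2
    have h3 : X ^ r * expand F n (u r) - C ((u r).eval 1) * X ^ r
        = X ^ r * (expand F n (u r) - C ((u r).eval 1)) := by ring
    rw [h3]
    exact h2.mul_left _
  · have hprod : (X ^ n - 1) ^ t * v
        = ∑ r ∈ Finset.range n, X ^ r * expand F n ((X - 1) ^ t * u r) := by
      conv_lhs => rw [hu, Finset.mul_sum]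
      refine Finset.sum_congr rfl fun r _ => ?_
      rw [map_mul, map_pow, hexp]
      ring
    rw [hprod]
    refine le_trans ?_ (sum_card_support_le n fun r => (X - 1) ^ t * u r)
    have hsub : (∑ r ∈ Finset.range n, C ((u r).eval 1) * X ^ r).support ⊆
        (Finset.range n).filter fun r => (u r).eval 1 ≠ 0 := by
      intro k hk
      rw [mem_support_iff, finsetSum_coeff] at hk
      obtain ⟨r, hr, hne⟩ := Finset.exists_ne_zero_of_sum_ne_zero hk
      rw [coeff_C_mul, coeff_X_pow] at hne
      have hkr : k = r := by
        by_contra h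
        exact hne (by rw [if_neg h, mul_zero])
      rw [hkr]
      exact Finset.mem_filter.2 ⟨hr, left_ne_zero_of_mul hne⟩
    refine (Nat.mul_le_mul_left _ (Finset.card_le_card hsub)).trans ?_
    rw [mul_comm, ← smul_eq_mul, ← Finset.sum_const]
    exact (Finset.sum_le_sum fun r hr => hP _ (Finset.mem_filter.1 hr).2).trans
      (Finset.sum_le_sum_of_subset (Finset.filter_subset _ _))

/-- The product of `a + 1` over the base-`p` digits `a` of `t`. In characteristic `p` this is the
weight of `(X - 1) ^ t`. -/
def digitProd (p t : ℕ) : ℕ := ((p.digits t).map (· + 1)).prod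

theorem digitProd_zero (p : ℕ) : digitProd p 0 = 1 := by simp [digitProd]

theorem digitProd_mul_add {p : ℕ} (hp : 1 < p) (a : ℕ) {b : ℕ} (hb : b < p) :
    digitProd p (p * a + b) = (b + 1) * digitProd p a := by
  rcases Nat.eq_zero_or_pos (p * a + b) with h | h
  · have ha : a = 0 := by
      have : p * a = 0 := by omega
      rcases Nat.mul_eq_zero.1 this with h' | h' <;> omega
    have hb : b = 0 := by omega
    simp [ha, hb, digitProd_zero]
  · rw [digitProd, Nat.digits_def' hp h, List.map_cons, List.prod_cons, Nat.mul_add_mod,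
      Nat.mod_eq_of_lt hb, Nat.mul_add_div (by omega), Nat.div_eq_of_lt hb, add_zero]
    rfl

theorem digitProd_eq {p : ℕ} (hp : 1 < p) (t : ℕ) :
    digitProd p t = (t % p + 1) * digitProd p (t / p) := by
  conv_lhs => rw [← Nat.div_add_mod t p]
  exact digitProd_mul_add hp _ (Nat.mod_lt _ (by omega))

theorem digitProd_pos (p t : ℕ) : 0 < digitProd p t := by
  refine Nat.pos_of_ne_zero fun h => ?_
  simp [digitProd, List.prod_eq_zero_iff] at h

/-- A polynomial that vanishes at `1` to order exactly `t` has at least `digitProd p t` terms. The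
last digit of `t` bounds the number of terms of the residue modulo `X ^ p - 1 = (X - 1) ^ p`, and
weight retention reduces the rest to `t / p`. -/
theorem Polynomial.digitProd_le_card_support {F : Type*} [Field F] (p : ℕ) [Fact p.Prime]
    [CharP F p] (t : ℕ) (v : F[X]) (hv : v.eval 1 ≠ 0) :
    digitProd p t ≤ ((X - 1) ^ t * v).support.card := by
  have hp : p.Prime := Fact.out
  induction t using Nat.strong_induction_on generalizing v with
  | _ t ih =>
    have hX : ¬ (X - 1 : F[X]) ∣ v := by
      rwa [← C_1, dvd_iff_isRoot]
    rcases Nat.eq_zero_or_pos t with rfl | ht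
    · rw [digitProd_zero, pow_zero, one_mul]
      exact Finset.card_pos.2 (nonempty_support_iff.2 (by rintro rfl; simp at hv))
    · have hfrob : (X ^ p - 1 : F[X]) = (X - 1) ^ p := by rw [sub_pow_char, one_pow]
      obtain ⟨r, hdeg, hdvd, hle⟩ := exists_mul_card_support_le p hp.pos (t / p)
        (digitProd p (t / p)) (fun w hw => ih _ (Nat.div_lt_self ht hp.one_lt) w hw)
        ((X - 1) ^ (t % p) * v)
      have hmod : t % p < p := Nat.mod_lt _ hp.pos
      rw [hfrob] at hdvd
      have hr0 : r ≠ 0 := by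
        rintro rfl
        rw [sub_zero] at hdvd
        have h1 : (X - 1 : F[X]) ^ (t % p) * (X - 1) ∣ (X - 1) ^ (t % p) * v := by
          rw [← pow_succ]
          exact (pow_dvd_pow _ hmod).trans hdvd
        exact hX ((mul_dvd_mul_iff_left (pow_ne_zero _ (X_sub_C_ne_zero (1 : F)))).1 h1)
      have hrdvd : (X - 1) ^ (t % p) ∣ r := by
        have := dvd_sub (dvd_mul_right ((X - 1 : F[X]) ^ (t % p)) v)
          ((pow_dvd_pow _ hmod.le).trans hdvd)
        rwa [sub_sub_cancel] at this
      have hw := lt_card_support_of_pow_dvd p _ r hr0 hdeg hrdvd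
      have hprod : (X ^ p - 1) ^ (t / p) * ((X - 1) ^ (t % p) * v) = (X - 1) ^ t * v := by
        rw [hfrob, ← pow_mul, ← mul_assoc, ← pow_add, Nat.div_add_mod]
      rw [hprod] at hle
      rw [digitProd_eq hp.one_lt, mul_comm]
      exact (Nat.mul_le_mul_left _ hw).trans hle

theorem Polynomial.card_support_X_sub_one_pow_le {F : Type*} [Field F] (p : ℕ) [Fact p.Prime]
    [CharP F p] (t : ℕ) : ((X - 1 : F[X]) ^ t).support.card ≤ digitProd p t := by
  have hp : p.Prime := Fact.out
  induction t using Nat.strong_induction_on with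
  | _ t ih =>
    rcases Nat.eq_zero_or_pos t with rfl | ht
    · rw [digitProd_zero, pow_zero]
      exact (card_support_le_one_iff_monomial.2 ⟨0, 1, rfl⟩)
    · have hprod : (X - 1 : F[X]) ^ t
          = (X - 1) ^ (t % p) * expand F p ((X - 1) ^ (t / p)) := by
        rw [map_pow, map_sub, expand_X, map_one, ← one_pow p, ← sub_pow_char, one_pow, ← pow_mul,
          ← pow_add, Nat.mod_add_div]
      rw [hprod, digitProd_eq hp.one_lt]
      refine card_support_mul_le.trans (Nat.mul_le_mul ?_ ?_)
      · refine (card_supp_le_succ_natDegree _).trans (Nat.succ_le_succ ?_)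
        rw [← C_1, natDegree_pow, natDegree_X_sub_C, mul_one]
      · exact (card_support_expand_le p hp.pos _).trans (ih _ (Nat.div_lt_self ht hp.one_lt))

/-! ### Words, polynomials and cyclic codes -/

/-- The polynomial `c₀ + c₁ x + ⋯ + c_{n-1} x^{n-1}` of a word. -/
def wordPoly {F : Type*} [Field F] {n : ℕ} (c : Fin n → F) : F[X] :=
  ∑ k : Fin n, C (c k) * X ^ (k : ℕ)

section
variable {F : Type*} [Field F] {n : ℕ}

theorem coeff_wordPoly (c : Fin n → F) (k : Fin n) : (wordPoly c).coeff k = c k := by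
  rw [wordPoly, finsetSum_coeff, Finset.sum_eq_single k]
  · simp
  · intro l _ hl
    rw [coeff_C_mul, coeff_X_pow, if_neg fun h => hl (Fin.ext h.symm), mul_zero]
  · exact fun h => absurd (Finset.mem_univ k) h

theorem wordPoly_injective : Function.Injective (wordPoly : (Fin n → F) → F[X]) := by
  intro c d h
  funext k
  rw [← coeff_wordPoly c, h, coeff_wordPoly]

theorem wordPoly_zero : wordPoly (0 : Fin n → F) = 0 := by simp [wordPoly]

theorem wordPoly_sub (c d : Fin n → F) : wordPoly (c - d) = wordPoly c - wordPoly d := by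
  simp [wordPoly, sub_mul, Finset.sum_sub_distrib]

theorem wordPoly_add (c d : Fin n → F) : wordPoly (c + d) = wordPoly c + wordPoly d := by
  simp [wordPoly, add_mul, Finset.sum_add_distrib]

theorem wordPoly_smul (a : F) (c : Fin n → F) : wordPoly (a • c) = C a * wordPoly c := by
  simp [wordPoly, Finset.mul_sum, mul_assoc]

theorem degree_wordPoly_lt (c : Fin n → F) : (wordPoly c).degree < n := by
  refine (degree_sum_le _ _).trans_lt ((Finset.sup_lt_iff (WithBot.bot_lt_coe n)).2 ?_)
  intro k _
  exact (degree_C_mul_X_pow_le _ _).trans_lt (Nat.cast_lt.2 k.2)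

theorem eq_zero_of_X_pow_sub_one_dvd {f : F[X]} (hn : 0 < n) (hf : f.degree < n)
    (h : X ^ n - 1 ∣ f) : f = 0 := by
  refine eq_zero_of_dvd_of_degree_lt h ?_
  rwa [← C_1, degree_X_pow_sub_C hn]

theorem card_support_wordPoly_le [DecidableEq F] (c : Fin n → F) :
    (wordPoly c).support.card ≤ hammingNorm c := by
  classical
  refine (Finset.card_le_card (?_ : _ ⊆ (Finset.univ.filter fun k => c k ≠ 0).image
    (fun k : Fin n => (k : ℕ)))).trans Finset.card_image_le
  intro k hk
  have hkn : k < n :=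
    (Nat.cast_lt (α := WithBot ℕ)).1 ((le_degree_of_mem_supp k hk).trans_lt (degree_wordPoly_lt c))
  refine Finset.mem_image.2 ⟨⟨k, hkn⟩, Finset.mem_filter.2 ⟨Finset.mem_univ _, ?_⟩, rfl⟩
  rw [← coeff_wordPoly c]
  exact mem_support_iff.1 hk

/-- Reduction modulo `X ^ n - 1` moves terms onto each other and does not increase the weight. -/
theorem exists_word_of_polynomial [DecidableEq F] (hn : 0 < n) (f : F[X]) :
    ∃ c : Fin n → F, X ^ n - 1 ∣ f - wordPoly c ∧ hammingNorm c ≤ f.support.card := by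
  -- The coefficients whose exponents agree modulo `n` are added up.
  let c : Fin n → F := fun k => ∑ m ∈ f.support.filter (fun m => m % n = k), f.coeff m
  refine ⟨c, ?_, ?_⟩
  · have hc : wordPoly c = ∑ m ∈ f.support, C (f.coeff m) * X ^ (m % n) := by
      rw [← Finset.sum_fiberwise_of_maps_to
        (t := (Finset.univ : Finset (Fin n))) (g := fun m => ⟨m % n, Nat.mod_lt m hn⟩)
        (fun _ _ => Finset.mem_univ _), wordPoly]
      refine Finset.sum_congr rfl fun k _ => ?_
      simp only [c, map_sum, Finset.sum_mul, Fin.ext_iff]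
      refine Finset.sum_congr rfl fun m hm => ?_
      rw [(Finset.mem_filter.1 hm).2]
    rw [hc]
    nth_rw 1 [f.as_sum_support_C_mul_X_pow]
    rw [← Finset.sum_sub_distrib]
    refine Finset.dvd_sum fun m _ => ?_
    have h : C (f.coeff m) * X ^ m - C (f.coeff m) * X ^ (m % n)
        = C (f.coeff m) * X ^ (m % n) * ((X ^ n) ^ (m / n) - 1) := by
      rw [mul_sub, mul_one, mul_assoc, ← pow_mul, ← pow_add, Nat.mod_add_div]
    rw [h]
    exact (sub_one_dvd_pow_sub_one _ _).mul_left _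
  · refine (Finset.card_le_card_of_surjOn (fun m : ℕ => (⟨m % n, Nat.mod_lt m hn⟩ : Fin n)) ?_)
    intro k hk
    have hk : c k ≠ 0 := by simpa using hk
    obtain ⟨m, hm, -⟩ := Finset.exists_ne_zero_of_sum_ne_zero hk
    rw [Finset.mem_filter] at hm
    exact ⟨m, hm.1, Fin.ext hm.2⟩

theorem mem_codeGeneratedBy_iff {g : F[X]} (hg : g ∣ X ^ n - 1) (c : Fin n → F) :
    c ∈ codeGeneratedBy n g ↔ g ∣ wordPoly c := by
  have h1 : c ∈ codeGeneratedBy n g ↔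
      (Ideal.Quotient.mk (Ideal.span {(X ^ n - 1 : F[X])}) (wordPoly c)) ∈
        Ideal.span {(Ideal.Quotient.mk (Ideal.span {(X ^ n - 1 : F[X])}) g)} := Iff.rfl
  rw [h1, ← Set.image_singleton (f := Ideal.Quotient.mk _), ← Ideal.map_span,
    Ideal.mem_quotient_iff_mem_sup,
    sup_eq_left.2 (Ideal.span_singleton_le_span_singleton.2 hg), Ideal.mem_span_singleton]

theorem X_pow_sub_one_dvd_X_mul_wordPoly_sub (c : Fin n → F) :
    X ^ n - 1 ∣ X * wordPoly c - wordPoly fun k => c ((finRotate n).symm k) := by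
  rw [wordPoly, wordPoly,
    ← Equiv.sum_comp (finRotate n) (fun k => C (c ((finRotate n).symm k)) * _),
    Finset.mul_sum, ← Finset.sum_sub_distrib]
  refine Finset.dvd_sum fun k _ => ?_
  rw [Equiv.symm_apply_apply]
  cases n with
  | zero => exact k.elim0
  | succ n =>
    rw [coe_finRotate]
    split_ifs with h
    · rw [h, Fin.val_last]
      exact ⟨C (c (Fin.last n)), by ring⟩
    · exact ⟨0, by ring⟩

/-- A cyclic code of length `n` is generated by a divisor of `X ^ n - 1`: the polynomials whose
residues modulo `X ^ n - 1` come from codewords form an ideal of the principal ideal domain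
`F[X]`. -/
theorem IsCyclicCode.exists_eq_codeGeneratedBy (hn : 0 < n) {𝒞 : Submodule F (Fin n → F)}
    (h𝒞 : IsCyclicCode 𝒞) : ∃ g : F[X], g ∣ X ^ n - 1 ∧ 𝒞 = codeGeneratedBy n g := by
  let I : Ideal F[X] :=
    { carrier := {f | ∃ c ∈ 𝒞, X ^ n - 1 ∣ f - wordPoly c}
      zero_mem' := ⟨0, 𝒞.zero_mem, by simp [wordPoly_zero]⟩
      add_mem' := by
        rintro f g ⟨c, hc, hf⟩ ⟨d, hd, hg⟩
        refine ⟨c + d, 𝒞.add_mem hc hd, ?_⟩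
        rw [wordPoly_add, add_sub_add_comm]
        exact dvd_add hf hg
      smul_mem' := by
        intro q f hf
        rw [smul_eq_mul]
        induction q using Polynomial.induction_on' with
        | add q r hq hr =>
          obtain ⟨c, hc, hq⟩ := hq
          obtain ⟨d, hd, hr⟩ := hr
          refine ⟨c + d, 𝒞.add_mem hc hd, ?_⟩
          rw [wordPoly_add, add_mul, add_sub_add_comm]
          exact dvd_add hq hr
        | monomial k a =>
          induction k with
          | zero =>
            obtain ⟨c, hc, hf⟩ := hf
            refine ⟨a • c, 𝒞.smul_mem a hc, ?_⟩
            rw [monomial_zero_left, wordPoly_smul, ← mul_sub]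
            exact hf.mul_left _
          | succ k ih =>
            obtain ⟨c, hc, hk⟩ := ih
            refine ⟨_, h𝒞 c hc, ?_⟩
            have h := dvd_add (hk.mul_left X) (X_pow_sub_one_dvd_X_mul_wordPoly_sub c)
            rwa [mul_sub, sub_add_sub_cancel, ← mul_assoc, X_mul_monomial] at h }
  obtain ⟨g, hg⟩ := (IsPrincipalIdealRing.principal I).principal
  have hmem : ∀ f, f ∈ I ↔ g ∣ f := fun f => by
    rw [hg]; exact Ideal.mem_span_singleton
  have hgn : g ∣ X ^ n - 1 := (hmem _).1 ⟨0, 𝒞.zero_mem, by simp [wordPoly_zero]⟩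
  refine ⟨g, hgn, ?_⟩
  ext c
  rw [mem_codeGeneratedBy_iff hgn, ← hmem]
  refine ⟨fun hc => ⟨c, hc, by simp⟩, ?_⟩
  rintro ⟨d, hd, h⟩
  rw [← wordPoly_sub] at h
  have h0 := eq_zero_of_X_pow_sub_one_dvd hn (degree_wordPoly_lt _) h
  rw [← wordPoly_zero] at h0
  rwa [sub_eq_zero.1 (wordPoly_injective h0)]

theorem codeGeneratedBy_congr {g h : F[X]} (hgh : Associated g h) (hg : g ∣ X ^ n - 1) :
    codeGeneratedBy n g = codeGeneratedBy n h := by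
  ext c
  rw [mem_codeGeneratedBy_iff hg, mem_codeGeneratedBy_iff (hgh.dvd_iff_dvd_left.1 hg),
    hgh.dvd_iff_dvd_left]

theorem minHammingDist_eq_zero {𝒞 : Submodule F (Fin n → F)} (h : ∀ c ∈ 𝒞, c = 0) :
    minHammingDist 𝒞 = 0 := by
  rw [minHammingDist]
  convert Nat.sInf_empty
  rw [Set.eq_empty_iff_forall_notMem]
  rintro d ⟨x, hx, y, hy, hne, -⟩
  exact hne ((h x hx).trans (h y hy).symm)

theorem minHammingDist_eq [DecidableEq F] {𝒞 : Submodule F (Fin n → F)} {d : ℕ}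
    (hlow : ∀ c ∈ 𝒞, c ≠ 0 → d ≤ hammingNorm c) (hup : ∃ c ∈ 𝒞, c ≠ 0 ∧ hammingNorm c ≤ d) :
    minHammingDist 𝒞 = d := by
  rw [minHammingDist, ← Subsingleton.elim ‹DecidableEq F› (Classical.decEq F)]
  refine IsLeast.csInf_eq ⟨?_, ?_⟩
  · obtain ⟨c, hc, hc0, hle⟩ := hup
    refine ⟨c, hc, 0, 𝒞.zero_mem, hc0, ?_⟩
    rw [hammingDist_zero_right]
    exact (hlow c hc hc0).antisymm hle
  · rintro _ ⟨x, hx, y, hy, hne, rfl⟩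
    rw [hammingDist_eq_hammingNorm]
    exact hlow _ (𝒞.add_mem (𝒞.neg_mem hx) hy) fun h => hne (neg_add_eq_zero.1 h)
end

theorem exists_associated_prod_pow_of_dvd {ι R : Type*} [CommRing R] [IsDomain R]
    [DecompositionMonoid R] (S : Finset ι) (q : ι → R) (hq : ∀ j, Prime (q j)) (N : ℕ) (g : R)
    (hg : g ∣ ∏ j ∈ S, q j ^ N) :
    ∃ i : ι → ℕ, (∀ j, i j ≤ N) ∧ Associated g (∏ j ∈ S, q j ^ i j) := by
  classical
  induction S using Finset.induction_on generalizing g with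
  | empty => exact ⟨0, fun _ => Nat.zero_le _, by simpa [associated_one_iff_isUnit,
      isUnit_iff_dvd_one] using hg⟩
  | insert a S ha ih =>
    rw [Finset.prod_insert ha] at hg
    obtain ⟨u, v, hu, hv, rfl⟩ := exists_dvd_and_dvd_of_dvd_mul hg
    obtain ⟨i, hi, hvi⟩ := ih v hv
    obtain ⟨k, hk, huk⟩ := (dvd_prime_pow (hq a) N).1 hu
    refine ⟨Function.update i a k, fun j => ?_, ?_⟩
    · rcases eq_or_ne j a with rfl | hj
      · rwa [Function.update_self]
      · rw [Function.update_of_ne hj]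
        exact hi j
    · rw [Finset.prod_insert ha, Function.update_self]
      refine huk.mul_mul ?_
      rwa [Finset.prod_congr rfl fun j hj => by
        rw [Function.update_of_ne (ne_of_mem_of_not_mem hj ha)]]

/-! ### The minimum distance in terms of digit products -/

theorem IsPrimitiveRoot.prod_X_sub_C_pow {F : Type*} [Field F] {n : ℕ} (hn : 0 < n) {ω : F}
    (hω : IsPrimitiveRoot ω n) : ∏ j : Fin n, (X - C (ω ^ (j : ℕ))) = X ^ n - 1 := by
  classical
  have hinj : Function.Injective fun j : Fin n => ω ^ (j : ℕ) := fun a b h =>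
    Fin.ext (hω.pow_inj a.2 b.2 h)
  have himage : Finset.univ.image (fun j : Fin n => ω ^ (j : ℕ)) = nthRootsFinset n (1 : F) := by
    refine Finset.eq_of_subset_of_card_le ?_ ?_
    · intro x hx
      obtain ⟨j, -, rfl⟩ := Finset.mem_image.1 hx
      rw [Polynomial.mem_nthRootsFinset hn, ← pow_mul, mul_comm, pow_mul, hω.pow_eq_one, one_pow]
    · rw [hω.card_nthRootsFinset, Finset.card_image_of_injective _ hinj, Finset.card_univ,
        Fintype.card_fin]
  rw [X_pow_sub_one_eq_prod hn hω, ← himage, Finset.prod_image hinj.injOn]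

theorem exists_X_pow_five_sub_one_eq_mul {F : Type*} [Field F] {ω : F}
    (hω : IsPrimitiveRoot ω 5) (j : Fin 5) :
    ∃ B : F[X], X ^ 5 - 1 = (X - C (ω ^ (j : ℕ))) * B ∧ B.eval (ω ^ (j : ℕ)) ≠ 0 := by
  refine ⟨∏ l ∈ Finset.univ.erase j, (X - C (ω ^ (l : ℕ))), ?_, ?_⟩
  · rw [Finset.mul_prod_erase _ (fun l : Fin 5 => X - C (ω ^ (l : ℕ))) (Finset.mem_univ j),
      hω.prod_X_sub_C_pow (by norm_num)]
  · rw [eval_prod, Finset.prod_ne_zero_iff]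
    intro l hl
    rw [eval_sub, eval_X, eval_C, sub_ne_zero]
    exact fun h => (Finset.mem_erase.1 hl).1 (Fin.ext (hω.pow_inj l.2 j.2 h.symm))

theorem X_pow_sub_one_eq_pow {F : Type*} [Field F] (p s : ℕ) [Fact p.Prime] [CharP F p] :
    (X ^ (5 * p ^ s) - 1 : F[X]) = (X ^ 5 - 1) ^ p ^ s := by
  rw [sub_pow_char_pow, one_pow, pow_mul]

/-- The numbers `(j + 1) P`, where `P` is the weight of `(x - 1) ^ t`, over all `j` and `t` with
`i_j ≤ t < p ^ s`. The least of them is the minimum distance of the code with exponents `i`. -/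
def weightSet (p s : ℕ) (i : Fin 5 → ℕ) : Set ℕ :=
  {w | ∃ (j : Fin 5) (t : ℕ), i j ≤ t ∧ t < p ^ s ∧ w = (j + 1) * digitProd p t}

section
variable {F : Type*} [Field F] {p s : ℕ} [Fact p.Prime] [CharP F p] {ω : F} {i : Fin 5 → ℕ}

theorem generatorPoly_dvd (hω : IsPrimitiveRoot ω 5) (hi : ∀ j, i j ≤ p ^ s) :
    generatorPoly ω i ∣ X ^ (5 * p ^ s) - 1 := by
  rw [X_pow_sub_one_eq_pow, ← hω.prod_X_sub_C_pow (by norm_num), ← Finset.prod_pow]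
  exact Finset.prod_dvd_prod_of_dvd _ _ fun j _ => pow_dvd_pow _ (hi j)

/-- Every nonzero codeword weighs at least an element of `weightSet`. If `X ^ 5 - 1` divides the
codeword exactly `t` times and `j` is the first index with `i_j ≤ t`, then the residue modulo
`X ^ 5 - 1` of the quotient still has the roots `1, …, ω ^ (j - 1)`, hence more than `j` terms,
and each of them is spread over at least `digitProd p t` terms of the codeword. -/
theorem exists_mem_weightSet_le_hammingNorm [DecidableEq F] (hω : IsPrimitiveRoot ω 5)
    (hi : ∀ j, i j ≤ p ^ s) {c : Fin (5 * p ^ s) → F}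
    (hc : c ∈ codeGeneratedBy (5 * p ^ s) (generatorPoly ω i)) (hc0 : c ≠ 0) :
    ∃ w ∈ weightSet p s i, w ≤ hammingNorm c := by
  have hp : p.Prime := Fact.out
  have hn : 0 < 5 * p ^ s := Nat.mul_pos (by norm_num) (pow_pos hp.pos s)
  rw [mem_codeGeneratedBy_iff (generatorPoly_dvd hω hi)] at hc
  have hf0 : wordPoly c ≠ 0 := fun h => hc0 (wordPoly_injective (h.trans wordPoly_zero.symm))
  have hmonic : (X ^ 5 - 1 : F[X]).Monic := by
    rw [← C_1]; exact monic_X_pow_sub_C _ (by norm_num)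
  have hpos : 0 < (X ^ 5 - 1 : F[X]).degree := by
    rw [← C_1, degree_X_pow_sub_C (by norm_num)]; norm_num
  obtain ⟨v, hf, hv⟩ :=
    (finiteMultiplicity_of_degree_pos_of_monic hpos hmonic hf0).exists_eq_pow_mul_and_not_dvd
  generalize multiplicity (X ^ 5 - 1) (wordPoly c) = t at hf
  -- Otherwise `X ^ n - 1 = (X ^ 5 - 1) ^ (p ^ s)` divides a nonzero polynomial of degree below `n`.
  have ht : t < p ^ s := by
    by_contra! h
    refine hf0 (eq_zero_of_X_pow_sub_one_dvd hn (degree_wordPoly_lt c) ?_)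
    rw [X_pow_sub_one_eq_pow, hf]
    exact (pow_dvd_pow _ h).mul_right _
  obtain ⟨r, hrdeg, hrdvd, hle⟩ := exists_mul_card_support_le 5 (by norm_num) t (digitProd p t)
    (fun w hw => digitProd_le_card_support p t w hw) v
  rw [← hf] at hle
  have hr0 : r ≠ 0 := by
    rintro rfl
    exact hv (by rwa [sub_zero] at hrdvd)
  have hroot : ∀ l : Fin 5, t < i l → r.eval (ω ^ (l : ℕ)) = 0 := by
    intro l hl
    obtain ⟨B, hB, hB0⟩ := exists_X_pow_five_sub_one_eq_mul hω l
    have h1 : (X - C (ω ^ (l : ℕ))) ^ (t + 1) ∣ wordPoly c :=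
      (pow_dvd_pow _ hl).trans ((Finset.dvd_prod_of_mem
        (fun j : Fin 5 => (X - C (ω ^ (j : ℕ))) ^ i j) (Finset.mem_univ l)).trans hc)
    rw [hf, hB, mul_pow, mul_assoc, pow_succ,
      mul_dvd_mul_iff_left (pow_ne_zero _ (X_sub_C_ne_zero _)), dvd_iff_isRoot, IsRoot.def,
      eval_mul, eval_pow, mul_eq_zero, or_iff_right (pow_ne_zero _ hB0)] at h1
    obtain ⟨q, hq⟩ := hrdvd
    have h2 := congrArg (eval (ω ^ (l : ℕ))) hq
    rw [hB, eval_sub, h1, eval_mul, eval_mul, eval_sub, eval_X, eval_C, sub_self, zero_mul,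
      zero_mul, zero_sub, neg_eq_zero] at h2
    exact h2
  -- A residue with all five roots would have more than five terms.
  have hex : ∃ k : ℕ, k < 5 ∧ ∀ h : k < 5, i ⟨k, h⟩ ≤ t := by
    by_contra! hcon
    have h1 := lt_card_support_of_roots hω 5 r hr0 hrdeg fun l hl => by
      obtain ⟨_, h⟩ := hcon l hl
      exact hroot ⟨l, hl⟩ h
    have h2 : r.support.card ≤ 5 := by
      refine (card_supp_le_succ_natDegree r).trans ?_
      have := (natDegree_lt_iff_degree_lt hr0).2 hrdeg
      omega
    omega
  classical
  obtain ⟨hk5, hkt⟩ := Nat.find_spec hex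
  have hw := lt_card_support_of_roots hω (Nat.find hex) r hr0 hrdeg fun l hl => by
    have := Nat.find_min hex hl
    push Not at this
    obtain ⟨_, h⟩ := this (hl.trans hk5)
    exact hroot ⟨l, hl.trans hk5⟩ h
  refine ⟨_, ⟨⟨Nat.find hex, hk5⟩, t, hkt hk5, ht, rfl⟩, ?_⟩
  rw [mul_comm]
  exact (Nat.mul_le_mul_left _ hw).trans (hle.trans (card_support_wordPoly_le c))

theorem Polynomial.card_support_pow_char_pow_le (f : F[X]) (p s : ℕ) [Fact p.Prime] [CharP F p] :
    (f ^ p ^ s).support.card ≤ f.support.card := by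
  have hp : p.Prime := Fact.out
  rw [← map_iterateFrobenius_expand p f s]
  exact (Finset.card_le_card (support_map_subset _ _)).trans
    (card_support_expand_le _ (pow_pos hp.pos s) _)

/-- The bound is attained: with `h = ∏_{l < j} (x - ω ^ l)`, the word
`h ^ (p ^ s) * (x ^ 5 - 1) ^ t` has at most `(j + 1) * digitProd p t` terms. -/
theorem exists_hammingNorm_le_of_mem_weightSet [DecidableEq F] (hω : IsPrimitiveRoot ω 5)
    (hi : ∀ j, i j ≤ p ^ s) (hanti : Antitone i) {w : ℕ} (hw : w ∈ weightSet p s i) :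
    ∃ c ∈ codeGeneratedBy (5 * p ^ s) (generatorPoly ω i), c ≠ 0 ∧ hammingNorm c ≤ w := by
  have hp : p.Prime := Fact.out
  have hn : 0 < 5 * p ^ s := Nat.mul_pos (by norm_num) (pow_pos hp.pos s)
  obtain ⟨j, t, hjt, ht, rfl⟩ := hw
  set h : F[X] := ∏ l : Fin 5, if l < j then X - C (ω ^ (l : ℕ)) else 1 with hh
  have hhcard : h.support.card ≤ j + 1 := by
    refine (card_supp_le_succ_natDegree h).trans (Nat.succ_le_succ ?_)
    refine (natDegree_prod_le _ _).trans ?_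
    calc ∑ l : Fin 5, (if l < j then X - C (ω ^ (l : ℕ)) else 1 : F[X]).natDegree
        = ∑ l : Fin 5, if l < j then 1 else 0 := by
          refine Finset.sum_congr rfl fun l _ => ?_
          split_ifs
          · exact natDegree_X_sub_C _
          · exact natDegree_one
      _ ≤ j := by fin_cases j <;> decide
  obtain ⟨c, hcdvd, hcw⟩ := exists_word_of_polynomial hn (h ^ p ^ s * (X ^ 5 - 1) ^ t)
  refine ⟨c, ?_, ?_, ?_⟩
  · rw [mem_codeGeneratedBy_iff (generatorPoly_dvd hω hi)]
    have h1 : generatorPoly ω i ∣ h ^ p ^ s * (X ^ 5 - 1) ^ t := by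
      rw [hh, ← hω.prod_X_sub_C_pow (by norm_num), ← Finset.prod_pow, ← Finset.prod_pow,
        ← Finset.prod_mul_distrib]
      refine Finset.prod_dvd_prod_of_dvd _ _ fun l _ => ?_
      split_ifs with hl
      · exact (pow_dvd_pow _ (hi l)).mul_right _
      · exact (pow_dvd_pow _ ((hanti (not_lt.1 hl)).trans hjt)).mul_left _
    have := dvd_sub h1 ((generatorPoly_dvd hω hi).trans hcdvd)
    rwa [sub_sub_cancel] at this
  · -- If the word were zero, `ω ^ j` would be a root of order `p ^ s` of the product above, while
    -- its order there is `t`.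
    rintro rfl
    rw [wordPoly_zero, sub_zero, X_pow_sub_one_eq_pow] at hcdvd
    obtain ⟨B, hB, hB0⟩ := exists_X_pow_five_sub_one_eq_mul hω j
    have h1 : (X - C (ω ^ (j : ℕ))) ^ (t + 1) ∣ h ^ p ^ s * (X ^ 5 - 1) ^ t := by
      refine (pow_dvd_pow _ ht).trans (dvd_trans ?_ hcdvd)
      rw [hB, mul_pow]
      exact dvd_mul_right _ _
    rw [hB, mul_pow, mul_left_comm, pow_succ,
      mul_dvd_mul_iff_left (pow_ne_zero _ (X_sub_C_ne_zero _)), dvd_iff_isRoot, IsRoot.def,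
      eval_mul, eval_pow, eval_pow, mul_eq_zero, or_iff_left (pow_ne_zero _ hB0)] at h1
    refine pow_ne_zero _ ?_ h1
    rw [hh, eval_prod, Finset.prod_ne_zero_iff]
    intro l _
    split_ifs with hl
    · rw [eval_sub, eval_X, eval_C, sub_ne_zero]
      exact fun h => hl.ne (Fin.ext (hω.pow_inj l.2 j.2 h.symm))
    · rw [eval_one]
      exact one_ne_zero
  · refine hcw.trans (card_support_mul_le.trans (Nat.mul_le_mul ?_ ?_))
    · exact (card_support_pow_char_pow_le h p s).trans hhcard
    · have : (X ^ 5 - 1 : F[X]) ^ t = expand F 5 ((X - 1) ^ t) := by simp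
      rw [this]
      exact (card_support_expand_le 5 (by norm_num) _).trans (card_support_X_sub_one_pow_le p t)

theorem minHammingDist_eq_of_isLeast (hω : IsPrimitiveRoot ω 5) (hi : ∀ j, i j ≤ p ^ s)
    (hanti : Antitone i) {d : ℕ} (hd : IsLeast (weightSet p s i) d) :
    minHammingDist (codeGeneratedBy (5 * p ^ s) (generatorPoly ω i)) = d := by
  classical
  refine minHammingDist_eq (fun c hc hc0 => ?_)
    (exists_hammingNorm_le_of_mem_weightSet hω hi hanti hd.1)
  obtain ⟨w, hw, hle⟩ := exists_mem_weightSet_le_hammingNorm hω hi hc hc0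
  exact (hd.2 hw).trans hle

theorem minHammingDist_eq_zero_of_forall_eq (hω : IsPrimitiveRoot ω 5)
    (hi : ∀ j, i j = p ^ s) :
    minHammingDist (codeGeneratedBy (5 * p ^ s) (generatorPoly ω i)) = 0 := by
  classical
  refine minHammingDist_eq_zero fun c hc => ?_
  by_contra hc0
  obtain ⟨_, ⟨j, t, h1, h2, -⟩, -⟩ :=
    exists_mem_weightSet_le_hammingNorm hω (fun j => (hi j).le) hc hc0
  rw [hi j] at h1
  omega

theorem exists_generatorPoly_of_isCyclicCode (hω : IsPrimitiveRoot ω 5)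
    {𝒞 : Submodule F (Fin (5 * p ^ s) → F)} (h𝒞 : IsCyclicCode 𝒞) :
    ∃ i : Fin 5 → ℕ, (∀ j, i j ≤ p ^ s) ∧
      𝒞 = codeGeneratedBy (5 * p ^ s) (generatorPoly ω i) := by
  have hp : p.Prime := Fact.out
  obtain ⟨g, hg, rfl⟩ :=
    h𝒞.exists_eq_codeGeneratedBy (Nat.mul_pos (by norm_num) (pow_pos hp.pos s))
  have hg' := hg
  rw [X_pow_sub_one_eq_pow, ← hω.prod_X_sub_C_pow (by norm_num), ← Finset.prod_pow] at hg'
  obtain ⟨i, hi, hgi⟩ := exists_associated_prod_pow_of_dvd _ _ (fun j => prime_X_sub_C _) _ g hg'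
  exact ⟨i, hi, codeGeneratedBy_congr hgi hg⟩
end

/-! ### Digit products and the table -/

section
variable {p : ℕ}

theorem digitProd_pow_mul (hp : 1 < p) (e a : ℕ) : digitProd p (p ^ e * a) = digitProd p a := by
  induction e with
  | zero => rw [pow_zero, one_mul]
  | succ e ih =>
    have := digitProd_mul_add hp (p ^ e * a) (b := 0) (by omega)
    rw [← ih, pow_succ', mul_assoc]
    simpa using this

theorem digitProd_pow_sub_one (hp : 1 < p) (k : ℕ) : digitProd p (p ^ k - 1) = p ^ k := by
  induction k with
  | zero => simp [digitProd_zero]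
  | succ k ih =>
    have hpos : 0 < p ^ k := pow_pos (by omega) k
    have h : p ^ (k + 1) - 1 = p * (p ^ k - 1) + (p - 1) := by
      obtain ⟨m, hm⟩ := Nat.exists_eq_add_of_lt hpos
      rw [pow_succ', hm, show 0 + m + 1 - 1 = m by omega, zero_add, mul_add]
      omega
    rw [h, digitProd_mul_add hp _ (by omega), ih, pow_succ', Nat.sub_add_cancel hp.le]

/-- Among the `e + τ + 1` base-`p` digits of `t`, the `τ` leading ones are all `p - 1` and the next
one is at least `β`. -/
theorem succ_mul_pow_le_digitProd (hp : 1 < p) {e τ β t : ℕ}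
    (h : p ^ e * (p * (p ^ τ - 1) + β) ≤ t) (ht : t < p ^ (e + τ + 1)) :
    (β + 1) * p ^ τ ≤ digitProd p t := by
  induction e generalizing t with
  | zero =>
    rw [pow_zero, one_mul] at h
    have hpos : 0 < p ^ τ := pow_pos (by omega) τ
    have hlt : t < p * (p ^ τ - 1) + p := by
      rw [← Nat.mul_add_one, Nat.sub_add_cancel hpos, ← pow_succ']
      rwa [zero_add] at ht
    have hb : t = p * (p ^ τ - 1) + (t - p * (p ^ τ - 1)) := by omega
    rw [hb, digitProd_mul_add hp _ (by omega), digitProd_pow_sub_one hp]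
    exact Nat.mul_le_mul_right _ (by omega)
  | succ e ih =>
    have h1 : p ^ e * (p * (p ^ τ - 1) + β) ≤ t / p := by
      rw [Nat.le_div_iff_mul_le (by omega)]
      calc _ = p ^ (e + 1) * (p * (p ^ τ - 1) + β) := by rw [pow_succ]; ring
        _ ≤ t := h
    have h2 : t / p < p ^ (e + τ + 1) := by
      rw [Nat.div_lt_iff_lt_mul (by omega), ← pow_succ]
      exact ht.trans_le (by rw [show e + 1 + τ + 1 = e + τ + 1 + 1 by omega])
    rw [digitProd_eq hp]
    exact (ih h1 h2).trans (Nat.le_mul_of_pos_left _ (Nat.succ_pos _))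

theorem add_two_mul_pow_le_digitProd (hp : 1 < p) {e τ β t : ℕ}
    (h : p ^ e * (p * (p ^ τ - 1) + β) < t) (ht : t < p ^ (e + τ + 1)) :
    (β + 2) * p ^ τ ≤ digitProd p t := by
  induction e generalizing t with
  | zero =>
    rw [pow_zero, one_mul] at h
    exact succ_mul_pow_le_digitProd (e := 0) hp (β := β + 1) (by rw [pow_zero]; omega) ht
  | succ e ih =>
    have hstep : p ^ (e + 1) * (p * (p ^ τ - 1) + β) = p ^ e * (p * (p ^ τ - 1) + β) * p := by
      rw [pow_succ]; ring
    have h1 : p ^ e * (p * (p ^ τ - 1) + β) ≤ t / p := by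
      rw [Nat.le_div_iff_mul_le (by omega), ← hstep]
      exact h.le
    have h2 : t / p < p ^ (e + τ + 1) := by
      rw [Nat.div_lt_iff_lt_mul (by omega), ← pow_succ]
      exact ht.trans_le (by rw [show e + 1 + τ + 1 = e + τ + 1 + 1 by omega])
    rw [digitProd_eq hp]
    rcases h1.lt_or_eq with h3 | h3
    · exact (ih h3 h2).trans (Nat.le_mul_of_pos_left _ (Nat.succ_pos _))
    · -- The leading digits agree, so the last digit is positive and doubles the product.
      have h4 : 1 ≤ t % p := by
        have h5 := Nat.div_add_mod t p
        rw [hstep, h3, mul_comm] at h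
        omega
      calc (β + 2) * p ^ τ ≤ (1 + 1) * ((β + 1) * p ^ τ) := by
            rw [← mul_assoc]; exact Nat.mul_le_mul_right _ (by omega)
        _ ≤ _ := Nat.mul_le_mul (by omega) (succ_mul_pow_le_digitProd hp h1 h2)

theorem pow_sub_pow_eq (e τ : ℕ) :
    p ^ (e + τ + 1) - p ^ (e + 1) = p ^ e * (p * (p ^ τ - 1)) := by
  rw [Nat.mul_sub, Nat.mul_sub]
  congr 1 <;> ring

theorem InPadicInterval.exists_eq (hp : 1 < p) {s β τ l : ℕ} (hs : 0 < s)
    (h : InPadicInterval p s β τ l) : ∃ e, s = e + τ + 1 ∧ β + 2 ≤ p ∧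
      p ^ e * (p * (p ^ τ - 1) + β) < l ∧ l ≤ p ^ e * (p * (p ^ τ - 1) + (β + 1)) := by
  obtain ⟨hβ, hτ, h1, h2⟩ := h
  obtain ⟨e, rfl⟩ : ∃ e, s = e + τ + 1 := ⟨s - τ - 1, by omega⟩
  rw [show e + τ + 1 - τ = e + 1 by omega, pow_sub_pow_eq, Nat.add_sub_cancel,
    mul_comm _ (p ^ e), ← mul_add] at h1 h2
  exact ⟨e, rfl, by omega, h1, h2⟩

theorem InPadicInterval.le_digitProd (hp : 1 < p) {s β τ l t : ℕ} (hs : 0 < s)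
    (h : InPadicInterval p s β τ l) (hlt : l ≤ t) (ht : t < p ^ s) :
    (β + 2) * p ^ τ ≤ digitProd p t := by
  obtain ⟨e, rfl, -, h1, -⟩ := h.exists_eq hp hs
  exact add_two_mul_pow_le_digitProd hp (h1.trans_le hlt) ht

/-- The right end of the interval has the least digit product beyond its left end. -/
theorem InPadicInterval.exists_digitProd_eq (hp : 1 < p) {s β τ l : ℕ} (hs : 0 < s)
    (h : InPadicInterval p s β τ l) :
    ∃ t, l ≤ t ∧ t < p ^ s ∧ digitProd p t = (β + 2) * p ^ τ := by
  obtain ⟨e, rfl, hβ, -, h2⟩ := h.exists_eq hp hs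
  refine ⟨_, h2, ?_, ?_⟩
  · have hpos : 0 < p ^ τ := pow_pos (by omega) τ
    calc p ^ e * (p * (p ^ τ - 1) + (β + 1)) < p ^ e * (p * (p ^ τ - 1) + p) :=
          Nat.mul_lt_mul_of_pos_left (by omega) (pow_pos (by omega) e)
      _ = p ^ (e + τ + 1) := by
          rw [← Nat.mul_add_one, Nat.sub_add_cancel hpos]; ring
  · rw [digitProd_pow_mul hp, digitProd_mul_add hp _ (by omega), digitProd_pow_sub_one hp]

/-- The intervals cover the numbers strictly between `0` and `p ^ s`. The parameter `τ` is explicit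
and monotone in `l`. -/
theorem exists_inPadicInterval (hp : 1 < p) {s l : ℕ} (hl : 0 < l) (hls : l < p ^ s) :
    ∃ β, InPadicInterval p s β (s - 1 - Nat.log p (p ^ s - l)) l := by
  -- With `u = p ^ s - l` and `p ^ e ≤ u < p ^ (e + 1)`, the interval is the set of all `l` for
  -- which `u / p ^ e` has a given value, namely `p - 1 - β`.
  obtain ⟨u, hu⟩ : ∃ u, u = p ^ s - l := ⟨_, rfl⟩
  obtain ⟨e, he⟩ : ∃ e, e = Nat.log p u := ⟨_, rfl⟩
  rw [← hu, ← he]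
  have hu0 : u ≠ 0 := by omega
  have hle : p ^ e ≤ u := he ▸ Nat.pow_log_le_self p hu0
  have hlt : u < p ^ (e + 1) := he ▸ Nat.lt_pow_succ_log_self hp u
  have hes : e < s := (Nat.pow_lt_pow_iff_right hp).1 (hle.trans_lt (by omega))
  obtain ⟨τ, rfl⟩ : ∃ τ, s = e + τ + 1 := ⟨s - e - 1, by omega⟩
  have hpe : 0 < p ^ e := pow_pos (by omega) e
  have hq1 : 1 ≤ u / p ^ e := (Nat.one_le_div_iff hpe).2 hle
  have hq2 : u / p ^ e < p := by
    rw [Nat.div_lt_iff_lt_mul hpe, ← pow_succ']; exact hlt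
  have hq3 : u / p ^ e * p ^ e ≤ u := Nat.div_mul_le_self _ _
  have hq4 : u < (u / p ^ e + 1) * p ^ e := (Nat.div_lt_iff_lt_mul hpe).1 (Nat.lt_succ_self _)
  obtain ⟨a, ha⟩ : ∃ a, a = u / p ^ e := ⟨_, rfl⟩
  rw [← ha] at hq1 hq2 hq3 hq4
  have hτ : e + τ + 1 - 1 - e = τ := by omega
  obtain ⟨β, rfl⟩ : ∃ β, p = β + 1 + a := ⟨p - 1 - a, by omega⟩
  rw [hτ]
  refine ⟨β, by omega, by omega, ?_, ?_⟩
  all_goals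
    rw [show e + τ + 1 - τ = e + 1 by omega, Nat.add_sub_cancel]
    have h1 : (β + 1 + a) ^ (e + 1) ≤ (β + 1 + a) ^ (e + τ + 1) :=
      Nat.pow_le_pow_right (by omega) (by omega)
    have h2 : (β + 1 + a) ^ (e + 1) = β * (β + 1 + a) ^ e + (β + 1 + a) ^ e
        + a * (β + 1 + a) ^ e := by ring
    have h3 : (β + 1) * (β + 1 + a) ^ e = β * (β + 1 + a) ^ e + (β + 1 + a) ^ e := by ring
    rw [add_mul, one_mul] at hq4
    omega

/-- The bounds on digit products that the rows with `i₄ = 0` use. -/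
theorem digitProd_lower_bounds (hp : 1 < p) {s t : ℕ} (hs : 0 < s) (ht : t < p ^ s) :
    1 ≤ digitProd p t ∧ (0 < t → 2 ≤ digitProd p t) ∧
      (p ^ (s - 1) < t → 3 ≤ digitProd p t) ∧ (2 * p ^ (s - 1) < t → 4 ≤ digitProd p t) ∧
      (3 * p ^ (s - 1) < t → 5 ≤ digitProd p t) := by
  have key : ∀ β, β * p ^ (s - 1) < t → β + 2 ≤ digitProd p t := by
    intro β h
    have := add_two_mul_pow_le_digitProd hp (e := s - 1) (τ := 0) (β := β) (t := t)
      (by simpa [mul_comm] using h) (by rwa [add_zero, Nat.sub_add_cancel hs])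
    simpa using this
  exact ⟨digitProd_pos p t, fun h => key 0 (by simpa using h), fun h => key 1 (by simpa using h),
    key 2, key 3⟩

theorem mem_weightSet {s : ℕ} {i : Fin 5 → ℕ} (j : Fin 5) {t w : ℕ} (hj : i j ≤ t)
    (ht : t < p ^ s) (hw : w = (j + 1) * digitProd p t) : w ∈ weightSet p s i :=
  ⟨j, t, hj, ht, hw⟩

theorem InPadicInterval.mem_weightSet (hp : 1 < p) {s β τ : ℕ} (hs : 0 < s) {i : Fin 5 → ℕ}
    (j : Fin 5) (h : InPadicInterval p s β τ (i j)) :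
    (j + 1) * (β + 2) * p ^ τ ∈ weightSet p s i := by
  obtain ⟨t, h1, h2, h3⟩ := h.exists_digitProd_eq hp hs
  exact ⟨j, t, h1, h2, by rw [h3, mul_assoc]⟩

theorem isLeast_weightSet {s : ℕ} {i : Fin 5 → ℕ} {d : ℕ} (hd : d ∈ weightSet p s i)
    (h0 : ∀ t, i 0 ≤ t → t < p ^ s → d ≤ 1 * digitProd p t)
    (h1 : ∀ t, i 1 ≤ t → t < p ^ s → d ≤ 2 * digitProd p t)
    (h2 : ∀ t, i 2 ≤ t → t < p ^ s → d ≤ 3 * digitProd p t)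
    (h3 : ∀ t, i 3 ≤ t → t < p ^ s → d ≤ 4 * digitProd p t)
    (h4 : ∀ t, i 4 ≤ t → t < p ^ s → d ≤ 5 * digitProd p t) : IsLeast (weightSet p s i) d := by
  refine ⟨hd, ?_⟩
  rintro _ ⟨j, t, hj, ht, rfl⟩
  fin_cases j
  exacts [h0 t hj ht, h1 t hj ht, h2 t hj ht, h3 t hj ht, h4 t hj ht]

theorem min_mem_of_mem {S : Set ℕ} {a b : ℕ} (ha : a ∈ S) (hb : b ∈ S) : min a b ∈ S := by
  rcases min_choice a b with h | h <;> rwa [h]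

/-- Every row of the table but the last one gives the least element of `weightSet`. In the last row,
which is the zero code, `weightSet` is empty. -/
theorem DistanceTable.isLeast_or (hp7 : 7 ≤ p) {s : ℕ} (hs : 0 < s) {i : Fin 5 → ℕ} {d : ℕ}
    (h : DistanceTable p s i d) :
    IsLeast (weightSet p s i) d ∨ d = 0 ∧ ∀ j, i j = p ^ s := by
  have hp : 1 < p := by omega
  have hpos : 0 < p ^ s := pow_pos (by omega) s
  have hmul : p ^ s = p * p ^ (s - 1) := by rw [← pow_succ', Nat.sub_add_cancel hs]
  have hq : 0 < p ^ (s - 1) := pow_pos (by omega) _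
  have hzero : ∀ j : Fin 5, i j = 0 → ((j : ℕ) + 1) ∈ weightSet p s i := fun j hj =>
    mem_weightSet j (t := 0) hj.le hpos (by rw [digitProd_zero, mul_one])
  have hsmall : ∀ (j : Fin 5) (β : ℕ), β < 5 → i j ≤ (β + 1) * p ^ (s - 1) →
      ((j : ℕ) + 1) * (β + 2) ∈ weightSet p s i := by
    intro j β hβ hj
    refine mem_weightSet j hj ?_ ?_
    · rw [hmul]; exact Nat.mul_lt_mul_of_pos_right (by omega) hq
    · have h1 := digitProd_mul_add hp 0 (b := β + 1) (by omega)
      rw [mul_zero, zero_add, digitProd_zero, mul_one] at h1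
      rw [mul_comm (β + 1), digitProd_pow_mul hp, h1]
  have low : ∀ {j : Fin 5} {k β τ t d : ℕ}, InPadicInterval p s β τ (i j) → i j ≤ t → t < p ^ s →
      d ≤ k * (β + 2) * p ^ τ → d ≤ k * digitProd p t := by
    intro j k β τ t d hI h1 h2 hd
    refine hd.trans ?_
    rw [mul_assoc]
    exact Nat.mul_le_mul_left _ (hI.le_digitProd hp hs h1 h2)
  have full : ∀ {j : Fin 5} {t k d : ℕ}, i j = p ^ s → i j ≤ t → t < p ^ s →
      d ≤ k * digitProd p t := fun h1 h2 h3 => absurd h3 (by omega)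
  have mem0 : ∀ {β τ : ℕ}, InPadicInterval p s β τ (i 0) → (β + 2) * p ^ τ ∈ weightSet p s i :=
    fun hI => by simpa using hI.mem_weightSet hp hs 0
  have mem1 : ∀ {β τ : ℕ}, InPadicInterval p s β τ (i 1) →
      2 * (β + 2) * p ^ τ ∈ weightSet p s i := fun hI => hI.mem_weightSet hp hs 1
  have mem2 : ∀ {β τ : ℕ}, InPadicInterval p s β τ (i 2) →
      3 * (β + 2) * p ^ τ ∈ weightSet p s i := fun hI => hI.mem_weightSet hp hs 2
  have mem3 : ∀ {β τ : ℕ}, InPadicInterval p s β τ (i 3) →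
      4 * (β + 2) * p ^ τ ∈ weightSet p s i := fun hI => hI.mem_weightSet hp hs 3
  have mem4 : ∀ {β τ : ℕ}, InPadicInterval p s β τ (i 4) →
      5 * (β + 2) * p ^ τ ∈ weightSet p s i := fun hI => hI.mem_weightSet hp hs 4
  cases h with
  | row1 h0 h1 h2 h3 h4 =>
    left
    refine isLeast_weightSet (hzero 0 h0) ?_ ?_ ?_ ?_ ?_ <;>
    · intro t _ ht
      have := digitProd_pos p t
      omega
  | row2 h0 h1 h2 h3 h4 =>
    left
    refine isLeast_weightSet (hsmall 0 0 (by omega) (by omega)) ?_ ?_ ?_ ?_ ?_ <;>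
    · intro t hi ht
      have := digitProd_lower_bounds hp hs ht
      omega
  | row3 h0 h1 h2 h3 h4 =>
    left
    refine isLeast_weightSet (hzero 1 h1) ?_ ?_ ?_ ?_ ?_ <;>
    · intro t hi ht
      have := digitProd_lower_bounds hp hs ht
      omega
  | row4 h0 h1 h2 h3 h4 =>
    left
    refine isLeast_weightSet (hsmall 0 1 (by omega) (by omega)) ?_ ?_ ?_ ?_ ?_ <;>
    · intro t hi ht
      have := digitProd_lower_bounds hp hs ht
      omega
  | row5 h0 h1 h2 h3 h4 =>
    left
    refine isLeast_weightSet (hzero 2 h2) ?_ ?_ ?_ ?_ ?_ <;>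
    · intro t hi ht
      have := digitProd_lower_bounds hp hs ht
      omega
  | row6 h0 h1 h2 h3 h4 =>
    left
    refine isLeast_weightSet (hsmall 0 2 (by omega) (by omega)) ?_ ?_ ?_ ?_ ?_ <;>
    · intro t hi ht
      have := digitProd_lower_bounds hp hs ht
      omega
  | row7 h0 h1 h2 h3 h4 =>
    left
    refine isLeast_weightSet (hzero 3 h3) ?_ ?_ ?_ ?_ ?_ <;>
    · intro t hi ht
      have := digitProd_lower_bounds hp hs ht
      omega
  | row8 h0 h1 h2 h3 h4 =>
    left
    refine isLeast_weightSet (hsmall 1 0 (by omega) (by omega)) ?_ ?_ ?_ ?_ ?_ <;>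
    · intro t hi ht
      have := digitProd_lower_bounds hp hs ht
      omega
  | row9 h0 h1 h2 h3 h4 =>
    left
    refine isLeast_weightSet (hzero 4 h4) ?_ ?_ ?_ ?_ ?_ <;>
    · intro t hi ht
      have := digitProd_lower_bounds hp hs ht
      omega
  | row10 β₀ β₁ β₂ β₃ β₄ τ₀ τ₁ τ₂ τ₃ τ₄ hτ h0 h1 h2 h3 h4 =>
    left
    exact isLeast_weightSet (min_mem_of_mem (mem0 h0) (min_mem_of_mem (mem1 h1)
        (min_mem_of_mem (mem2 h2) (min_mem_of_mem (mem3 h3) (mem4 h4)))))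
      (fun t a b => low h0 a b (by simp)) (fun t a b => low h1 a b (by simp))
      (fun t a b => low h2 a b (by simp)) (fun t a b => low h3 a b (by simp))
      (fun t a b => low h4 a b (by simp))
  | row11 β₁ β₂ β₃ β₄ τ₁ τ₂ τ₃ τ₄ hτ h0 h1 h2 h3 h4 =>
    left
    exact isLeast_weightSet (min_mem_of_mem (mem1 h1)
        (min_mem_of_mem (mem2 h2) (min_mem_of_mem (mem3 h3) (mem4 h4))))
      (fun t a b => full h0 a b) (fun t a b => low h1 a b (by simp))
      (fun t a b => low h2 a b (by simp)) (fun t a b => low h3 a b (by simp))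
      (fun t a b => low h4 a b (by simp))
  | row12 β₂ β₃ β₄ τ₂ τ₃ τ₄ hτ h0 h1 h2 h3 h4 =>
    left
    exact isLeast_weightSet (min_mem_of_mem (mem2 h2) (min_mem_of_mem (mem3 h3) (mem4 h4)))
      (fun t a b => full h0 a b) (fun t a b => full h1 a b)
      (fun t a b => low h2 a b (by simp)) (fun t a b => low h3 a b (by simp))
      (fun t a b => low h4 a b (by simp))
  | row13 β₃ β₄ τ₃ τ₄ hτ h0 h1 h2 h3 h4 =>
    left
    exact isLeast_weightSet (min_mem_of_mem (mem3 h3) (mem4 h4))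
      (fun t a b => full h0 a b) (fun t a b => full h1 a b) (fun t a b => full h2 a b)
      (fun t a b => low h3 a b (by simp)) (fun t a b => low h4 a b (by simp))
  | row14 β₄ τ₄ h0 h1 h2 h3 h4 =>
    left
    exact isLeast_weightSet (mem4 h4)
      (fun t a b => full h0 a b) (fun t a b => full h1 a b) (fun t a b => full h2 a b)
      (fun t a b => full h3 a b) (fun t a b => low h4 a b le_rfl)
  | row15 h0 h1 h2 h3 h4 =>
    right
    refine ⟨rfl, fun j => ?_⟩
    fin_cases j
    exacts [h0, h1, h2, h3, h4]

theorem DistanceTable.exists_row (hp7 : 7 ≤ p) {s : ℕ} (hs : 0 < s) {i : Fin 5 → ℕ}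
    (h43 : i 4 ≤ i 3) (h32 : i 3 ≤ i 2) (h21 : i 2 ≤ i 1) (h10 : i 1 ≤ i 0) (h0 : i 0 ≤ p ^ s) :
    ∃ d, DistanceTable p s i d := by
  have hp : 1 < p := by omega
  have hmul : p ^ s = p * p ^ (s - 1) := by rw [← pow_succ', Nat.sub_add_cancel hs]
  have hq : 7 * p ^ (s - 1) ≤ p ^ s := by rw [hmul]; exact Nat.mul_le_mul_right _ hp7
  rcases Nat.eq_zero_or_pos (i 4) with h4 | h4
  · by_cases c0 : i 0 = 0
    · exact ⟨_, .row1 c0 (by omega) (by omega) (by omega) h4⟩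
    by_cases c1 : i 0 ≤ p ^ (s - 1)
    · exact ⟨_, .row2 (by omega) (by omega) (by omega) (by omega) h4⟩
    by_cases c2 : i 1 = 0
    · exact ⟨_, .row3 (by omega) c2 (by omega) (by omega) h4⟩
    by_cases c3 : i 0 ≤ 2 * p ^ (s - 1)
    · exact ⟨_, .row4 (by omega) (by omega) (by omega) (by omega) h4⟩
    by_cases c4 : i 2 = 0
    · exact ⟨_, .row5 (by omega) (by omega) c4 (by omega) h4⟩
    by_cases c5 : i 0 ≤ 3 * p ^ (s - 1)
    · exact ⟨_, .row6 (by omega) (by omega) (by omega) (by omega) h4⟩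
    by_cases c6 : i 3 = 0
    · exact ⟨_, .row7 (by omega) (by omega) (by omega) c6 h4⟩
    by_cases c7 : i 1 ≤ p ^ (s - 1)
    · exact ⟨_, .row8 (by omega) (by omega) (by omega) (by omega) h4⟩
    · exact ⟨_, .row9 (by omega) (by omega) (by omega) (by omega) h4⟩
  · have hτ : ∀ {a b : ℕ}, a ≤ b →
        s - 1 - Nat.log p (p ^ s - a) ≤ s - 1 - Nat.log p (p ^ s - b) := by
      intro a b hab
      exact Nat.sub_le_sub_left (Nat.log_mono_right (Nat.sub_le_sub_left hab _)) _
    have hI : ∀ j, 0 < i j → i j ≠ p ^ s → i j ≤ p ^ s →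
        ∃ β, InPadicInterval p s β (s - 1 - Nat.log p (p ^ s - i j)) (i j) :=
      fun j h1 h2 h3 => exists_inPadicInterval hp h1 (h3.lt_of_ne h2)
    by_cases c4 : i 4 = p ^ s
    · exact ⟨_, .row15 (by omega) (by omega) (by omega) (by omega) c4⟩
    obtain ⟨β₄, I4⟩ := hI 4 h4 c4 (by omega)
    by_cases c3 : i 3 = p ^ s
    · exact ⟨_, .row14 _ _ (by omega) (by omega) (by omega) c3 I4⟩
    obtain ⟨β₃, I3⟩ := hI 3 (by omega) c3 (by omega)
    by_cases c2 : i 2 = p ^ s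
    · exact ⟨_, .row13 _ _ _ _ (hτ h43) (by omega) (by omega) c2 I3 I4⟩
    obtain ⟨β₂, I2⟩ := hI 2 (by omega) c2 (by omega)
    by_cases c1 : i 1 = p ^ s
    · exact ⟨_, .row12 _ _ _ _ _ _ ⟨hτ h43, hτ h32⟩ (by omega) c1 I2 I3 I4⟩
    obtain ⟨β₁, I1⟩ := hI 1 (by omega) c1 (by omega)
    by_cases c0 : i 0 = p ^ s
    · exact ⟨_, .row11 _ _ _ _ _ _ _ _ ⟨hτ h43, hτ h32, hτ h21⟩ c0 I1 I2 I3 I4⟩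
    obtain ⟨β₀, I0⟩ := hI 0 (by omega) c0 (by omega)
    exact ⟨_, .row10 _ _ _ _ _ _ _ _ _ _ ⟨hτ h43, hτ h32, hτ h21, hτ h10⟩ I0 I1 I2 I3 I4⟩

end

end

theorem mainTheorem1 {F : Type*} [Field F] [Finite F] (p m s : ℕ)
    (hp : p.Prime) (hp7 : 7 ≤ p) (hm : 0 < m) (hs : 0 < s)
    (hF : Nat.card F = p ^ m) (h5 : 5 ∣ p ^ m - 1)
    (ω : F) (hω : IsPrimitiveRoot ω 5) :
    (∀ 𝒞 : Submodule F (Fin (5 * p ^ s) → F), IsCyclicCode 𝒞 →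
      ∃ i : Fin 5 → ℕ, (∀ j, i j ≤ p ^ s) ∧
        𝒞 = codeGeneratedBy (5 * p ^ s) (generatorPoly ω i)) ∧
    (∀ i : Fin 5 → ℕ, i 4 ≤ i 3 → i 3 ≤ i 2 → i 2 ≤ i 1 → i 1 ≤ i 0 → i 0 ≤ p ^ s →
      (∃ d, DistanceTable p s i d) ∧
      ∀ d, DistanceTable p s i d →
        minHammingDist (codeGeneratedBy (5 * p ^ s) (generatorPoly ω i)) = d) := by
  have : Fact p.Prime := ⟨hp⟩
  have : CharP F p := by
    have := Fintype.ofFinite F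
    exact charP_of_card_eq_prime_pow (f := m) (by rw [← Nat.card_eq_fintype_card, hF])
  refine ⟨fun 𝒞 h𝒞 => exists_generatorPoly_of_isCyclicCode hω h𝒞, ?_⟩
  intro i h43 h32 h21 h10 h0
  refine ⟨DistanceTable.exists_row hp7 hs h43 h32 h21 h10 h0, fun d hd => ?_⟩
  have hanti : Antitone i := by
    rw [Fin.antitone_iff_succ_le]
    intro j
    fin_cases j
    exacts [h10, h21, h32, h43]
  rcases hd.isLeast_or hp7 hs with h | ⟨rfl, h⟩
  · exact minHammingDist_eq_of_isLeast hω (fun j => (hanti (Fin.zero_le j)).trans h0) hanti h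
  · exact minHammingDist_eq_zero_of_forall_eq hω h
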